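/- Setting. Let $G=(V,E)$ be a finite directed acyclic multigraph with unit-capacity edges and four distinct nodes $s_1,s_2$ (sources) and $t_1,t_2$ (terminals), with no edge entering a source and no edge leaving a terminal. For nonempty $A,B\subseteq\{1,2\}$ let $k_{A-B}$ be the minimum number of edges whose removal leaves no directed path from $\{s_i:i\in A\}$ to $\{t_j:j\in B\}$ (we write $k_{12-1}$ for $k_{\{1,2\}-\{1\}}$, etc.). A linear network code over a finite field $F$ consists of local coefficients $f_{e',e}\in F$ for consecutive edges $e',e$ and encoding matrices $M_1,M_2$, where $M_i$ has $R_i$ columns and its rows are indexed by the edges leaving $s_i$. For messages $X_i\in F^{R_i}$, the edges leaving $s_i$ carry the entries of $M_iX_i$, and every other edge $e$ carries $Y_e=\sum_{e'} f_{e',e}Y_{e'}$, summed over the edges $e'$ entering the tail of $e$. Let $H_{ij}$ be the resulting transfer matrix from the edges leaving $s_j$ to the edges entering $t_i$, so that $t_i$ receives $Z_i=H_{i1}M_1X_1+H_{i2}M_2X_2$. A pair $(R_1,R_2)$ of non-negative integers is achievable with local coefficients $f$ if, for suitable $M_1,M_2$ with $R_1$ and $R_2$ columns, $Z_1$ determines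 $X_1$ and $Z_2$ determines $X_2$ for all $X_1\in F^{R_1}$, $X_2\in F^{R_2}$. Let $R_2^{**}=\min(k_{2-1},k_{2-2})$ and $R_1^{**}=\min\bigl(\min(k_{1-2},k_{1-1}),\ \min(k_{12-1},k_{12-2})-R_2^{**}\bigr)$ be the coordinates of the boundary point $Q_2$ of the base (multicast) region. Call $(f,M_1,M_2)$ over $F$ an admissible choice at $Q_2$ if $\operatorname{rank}H_{ij}=k_{j-i}$ and $\operatorname{rank}[H_{i1}\ H_{i2}]=k_{12-i}$ for all $i,j\in\{1,2\}$, and $M_1,M_2$ have $R_1^{**},R_2^{**}$ columns and satisfy $\operatorname{rank}[H_{i1}M_1\ \ H_{i2}M_2]=R_1^{**}+R_2^{**}$ for $i=1,2$ (both terminals decode both sources). Corollary (Region 3). Suppose $k_{1-2}+k_{2-1}\ge\min(k_{12-1},k_{12-2})$ and $k_{2-1}\le k_{2-2}$. Then: (a) there is $q_0$ such that over every finite field with at least $q_0$ elements an admissible choice at $Q_2$ exists; (b) for every finite field $F$ and every admissible choice $(f,M_1,M_2)$ at $Q_2$ over $F$, every pair $(R_1,R_2)$ of non-negative integers with $$R_1\le\min(k_{12-1},k_{12-2})-k_{2-1},\qquad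 R_2\le k_{2-2},\qquad R_1+R_2\le\operatorname{rank}\bigl([H_{21}M_1\ \ H_{22}]\bigr)$$ is achievable over $F$ with the same local coefficients $f$ (and, in general, new encoding matrices). -/

import Mathlib

/-- A directed acyclic multigraph with node type `V` and unit-capacity edges `E`, with two
source-terminal pairs `(s 0, t 0)` and `(s 1, t 1)`. The indices `0, 1 : Fin 2` stand for the
sessions `1, 2`. -/
structure TwoUnicast (V E : Type*) where
  tail : E → V
  head : E → V
  acyclic : ∀ v, ¬ Relation.TransGen (fun u w => ∃ e, tail e = u ∧ head e = w) v v
  s : Fin 2 → V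
  t : Fin 2 → V
  s_injective : Function.Injective s
  t_injective : Function.Injective t
  s_ne_t : ∀ i j, s i ≠ t j
  no_edge_into_source : ∀ e i, head e ≠ s i
  no_edge_out_of_terminal : ∀ e i, tail e ≠ t i

namespace TwoUnicast

/-- Edges leaving the node `v`. -/
abbrev Out {V E : Type*} (N : TwoUnicast V E) (v : V) : Type _ := {e : E // N.tail e = v}

/-- Edges entering the node `v`. -/
abbrev In {V E : Type*} (N : TwoUnicast V E) (v : V) : Type _ := {e : E // N.head e = v}

/-- Deleting the edges in `C` leaves no directed path from a node of `A` to a node of `B`. -/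
def Separates {V E : Type*} (N : TwoUnicast V E) (C : Finset E) (A B : Set V) : Prop :=
  ∀ a ∈ A, ∀ b ∈ B,
    ¬ Relation.ReflTransGen (fun u w => ∃ e, e ∉ C ∧ N.tail e = u ∧ N.head e = w) a b

/-- The minimum cut between the sources indexed by `A` and the terminals indexed by `B`: the
least number of edges whose deletion separates them. For instance `N.cut {0, 1} {0}` is
the cut value `k_{12-1}`. -/
noncomputable def cut {V E : Type*} (N : TwoUnicast V E) (A B : Set (Fin 2)) : ℕ :=
  sInf {n : ℕ | ∃ C : Finset E, C.card = n ∧ N.Separates C (N.s '' A) (N.t '' B)}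

/-- By acyclicity, signals can be computed edge by edge. -/
theorem wellFounded_edge {V E : Type*} [Finite E] (N : TwoUnicast V E) :
    WellFounded (fun e' e : E => N.head e' = N.tail e) := by
  have key : ∀ a b : E, Relation.TransGen (fun e' e : E => N.head e' = N.tail e) a b →
      Relation.TransGen (fun u w => ∃ e, N.tail e = u ∧ N.head e = w) (N.tail a) (N.tail b) := by
    intro a b h
    induction h with
    | single h => exact Relation.TransGen.single ⟨a, rfl, h⟩
    | tail _ h ih => exact ih.tail ⟨_, rfl, h⟩
  have : IsTrans E (Relation.TransGen (fun e' e : E => N.head e' = N.tail e)) :=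
    ⟨fun _ _ _ h h' => h.trans h'⟩
  have : Std.Irrefl (Relation.TransGen (fun e' e : E => N.head e' = N.tail e)) :=
    ⟨fun a h => N.acyclic _ (key a a h)⟩
  have wf := Finite.wellFounded_of_trans_of_irrefl
    (Relation.TransGen (fun e' e : E => N.head e' = N.tail e))
  exact Subrelation.wf (r := Relation.TransGen (fun e' e : E => N.head e' = N.tail e))
    (fun {_ _} h => Relation.TransGen.single h) wf

section Signals

variable {V E F : Type*} [Fintype E] [DecidableEq V] [Field F]

/-- The signals on all edges, for the local coding coefficients `f e' e` (used only for
consecutive edges `e'`, `e`), when the symbols `x e` are injected on the edges `e`. -/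
noncomputable def edgeSignal (N : TwoUnicast V E) (f : E → E → F) (x : E → F) : E → F :=
  N.wellFounded_edge.fix fun e Y =>
    x e + ∑ e' : N.In (N.tail e), f e'.1 e * Y e'.1 e'.2

theorem edgeSignal_eq (N : TwoUnicast V E) (f : E → E → F) (x : E → F) (e : E) :
    N.edgeSignal f x e =
      x e + ∑ e' : N.In (N.tail e), f e'.1 e * N.edgeSignal f x e'.1 := by
  unfold edgeSignal
  rw [WellFounded.fix_eq]

/-- The symbols injected into the network when source `1` emits `u₁` and source `2` emits `u₂` on
their outgoing edges; nothing is injected elsewhere. -/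
def injected (N : TwoUnicast V E) (u₁ : N.Out (N.s 0) → F) (u₂ : N.Out (N.s 1) → F) : E → F :=
  fun e =>
    if h : N.tail e = N.s 0 then u₁ ⟨e, h⟩
    else if h : N.tail e = N.s 1 then u₂ ⟨e, h⟩
    else 0

/-- The signal on every edge of the network when the sources emit `u₁` and `u₂`. -/
noncomputable def signal (N : TwoUnicast V E) (f : E → E → F)
    (u₁ : N.Out (N.s 0) → F) (u₂ : N.Out (N.s 1) → F) : E → F :=
  N.edgeSignal f (N.injected u₁ u₂)

theorem signal_of_tail_eq_source_one (N : TwoUnicast V E) (f : E → E → F)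
    (u₁ : N.Out (N.s 0) → F) (u₂ : N.Out (N.s 1) → F) (e : N.Out (N.s 0)) :
    N.signal f u₁ u₂ e.1 = u₁ e := by
  obtain ⟨e, he⟩ := e
  have : IsEmpty (N.In (N.tail e)) :=
    ⟨fun e' => N.no_edge_into_source e'.1 0 (e'.2.trans he)⟩
  simp [signal, edgeSignal_eq N f _ e, injected, he]

theorem signal_of_tail_eq_source_two (N : TwoUnicast V E) (f : E → E → F)
    (u₁ : N.Out (N.s 0) → F) (u₂ : N.Out (N.s 1) → F) (e : N.Out (N.s 1)) :
    N.signal f u₁ u₂ e.1 = u₂ e := by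
  obtain ⟨e, he⟩ := e
  have : IsEmpty (N.In (N.tail e)) :=
    ⟨fun e' => N.no_edge_into_source e'.1 1 (e'.2.trans he)⟩
  have h01 : N.s 1 ≠ N.s 0 := fun h => by simpa using N.s_injective h
  simp [signal, edgeSignal_eq N f _ e, injected, he, h01]

theorem signal_of_tail_ne_source (N : TwoUnicast V E) (f : E → E → F)
    (u₁ : N.Out (N.s 0) → F) (u₂ : N.Out (N.s 1) → F) (e : E) (he : ∀ i, N.tail e ≠ N.s i) :
    N.signal f u₁ u₂ e = ∑ e' : N.In (N.tail e), f e'.1 e * N.signal f u₁ u₂ e'.1 := by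
  unfold signal
  rw [edgeSignal_eq]
  simp [injected, he 0, he 1]

/-- The vector `Z_i` received at terminal `t i`. -/
noncomputable def received (N : TwoUnicast V E) (f : E → E → F) (i : Fin 2)
    (u₁ : N.Out (N.s 0) → F) (u₂ : N.Out (N.s 1) → F) : N.In (N.t i) → F :=
  fun d => N.signal f u₁ u₂ d.1

/-- The transfer matrix `H_{ij}` from source `s j` (its outgoing edges) to terminal `t i` (its
incoming edges): column `e` is what `t i` receives when a unit symbol is injected on `e`. -/
noncomputable def transfer [DecidableEq E] (N : TwoUnicast V E) (f : E → E → F) (i j : Fin 2) :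
    Matrix (N.In (N.t i)) (N.Out (N.s j)) F :=
  Matrix.of fun d e => N.edgeSignal f (Pi.single e.1 1) d.1

/-- The local coding coefficients are chosen so that `H_{ij}` and `[H_{i1} H_{i2}]` all have the
maximum possible ranks, the corresponding cut values. -/
structure HasCutRanks [DecidableEq E] (N : TwoUnicast V E) (f : E → E → F) : Prop where
  rank_transfer : ∀ i j, (N.transfer f i j).rank = N.cut {j} {i}
  rank_fromCols : ∀ i,
    (Matrix.fromCols (N.transfer f i 0) (N.transfer f i 1)).rank = N.cut {0, 1} {i}

/-- With encoding matrices `M₁`, `M₂` both terminals receive both sources at full rate: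
`[H_{i1} M₁  H_{i2} M₂]` has full column rank `r₁ + r₂` for both terminals. -/
def IsMulticast [DecidableEq E] (N : TwoUnicast V E) (f : E → E → F) {r₁ r₂ : ℕ}
    (M₁ : Matrix (N.Out (N.s 0)) (Fin r₁) F) (M₂ : Matrix (N.Out (N.s 1)) (Fin r₂) F) : Prop :=
  ∀ i, (Matrix.fromCols (N.transfer f i 0 * M₁) (N.transfer f i 1 * M₂)).rank = r₁ + r₂

/-- The rate pair `(R₁, R₂)` is achieved over the field `F` with local coding coefficients `f`:
for suitable source encoding matrices, terminal `1` can recover `X₁` and terminal `2` can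
recover `X₂`, for all messages `X₁ ∈ F^R₁` and `X₂ ∈ F^R₂`. -/
def AchievableWith (N : TwoUnicast V E) (f : E → E → F) (R₁ R₂ : ℕ) : Prop :=
  ∃ (M₁ : Matrix (N.Out (N.s 0)) (Fin R₁) F) (M₂ : Matrix (N.Out (N.s 1)) (Fin R₂) F)
    (D₁ : (N.In (N.t 0) → F) → (Fin R₁ → F)) (D₂ : (N.In (N.t 1) → F) → (Fin R₂ → F)),
    ∀ (X₁ : Fin R₁ → F) (X₂ : Fin R₂ → F),
      D₁ (N.received f 0 (M₁.mulVec X₁) (M₂.mulVec X₂)) = X₁ ∧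
      D₂ (N.received f 1 (M₁.mulVec X₁) (M₂.mulVec X₂)) = X₂

end Signals

/-- Second coordinate `R₂**` of the boundary point `Q₂` of the base region. -/
noncomputable def rateQ₂two {V E : Type*} (N : TwoUnicast V E) : ℕ :=
  min (N.cut {1} {0}) (N.cut {1} {1})

/-- First coordinate `R₁**` of the boundary point `Q₂` of the base region. The subtraction never
truncates, since `k_{2-1} ≤ k_{12-1}` and `k_{2-2} ≤ k_{12-2}`. -/
noncomputable def rateQ₂one {V E : Type*} (N : TwoUnicast V E) : ℕ :=
  min (min (N.cut {0} {1}) (N.cut {0} {0}))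
    (min (N.cut {0, 1} {0}) (N.cut {0, 1} {1}) - N.rateQ₂two)

end TwoUnicast

/-! Part (b): since k_{2-1} ≤ k_{2-2}, the second rate at Q₂ is the full rank of H₁₂. Decodability
at terminal 1 therefore puts H₁₁M₁ in direct sum with the whole column space of H₁₂, so terminal 1
tolerates any encoding at source 2, and M₁ may be thinned to M₁A (`IsMulticast.achievableWith`). At
terminal 2, generic A and M₂' attain every rate pair that the ranks permit. Only two subspaces must
be avoided at a time, so every finite field is large enough.

Part (a): go through the edges in topological order and let each coding vector leave every span of
earlier vectors that it can leave. Eliminating edges backwards then turns the rank seen at a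
terminal into a bound on the size of a blocking set (`exists_blocking_card_le`), while every cut
bounds that rank from above. Hence all ranks equal their min-cuts simultaneously. Encoding matrices
are built column by column, again by avoiding proper subspaces
(`Matrix.exists_min_le_finrank_range_mul_sup`). -/

/-! ### Generic vectors and matrices over finite fields -/

open Module in
/-- A vector space over a finite field with at least `n` elements is not the union of `n` proper
subspaces. -/
theorem Submodule.exists_forall_notMem_of_card_le {K M ι : Type*} [Field K] [Finite K]
    [AddCommGroup M] [Module K M] (p : ι → Submodule K M) (s : Finset ι)
    (hs : s.card ≤ Nat.card K) (hp : ∀ i ∈ s, p i ≠ ⊤) : ∃ v, ∀ i ∈ s, v ∉ p i := by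
  classical
  induction s using Finset.induction_on with
  | empty => exact ⟨0, by simp⟩
  | insert a s ha ih =>
    rw [Finset.card_insert_of_notMem ha] at hs
    obtain ⟨v, hv⟩ := ih (by omega) fun i hi => hp i (Finset.mem_insert_of_mem hi)
    by_cases hva : v ∈ p a
    swap
    · exact ⟨v, by simpa [hva] using hv⟩
    obtain ⟨u, hu⟩ : ∃ u, u ∉ p a := by
      by_contra! h
      exact hp a (Finset.mem_insert_self a s) (Submodule.eq_top_iff'.2 h)
    by_contra! h
    -- The line u + c • v misses `p a`, so each of its points lies in some `p i` with i in s. Two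
    -- points in the same `p i` would put v there, so the field would embed in s, which is too
    -- small.
    have key : ∀ c : K, ∃ i ∈ s, u + c • v ∈ p i := by
      intro c
      obtain ⟨i, hi, hmem⟩ := h (u + c • v)
      rcases Finset.mem_insert.1 hi with rfl | hi
      · exact absurd ((Submodule.add_mem_iff_left _ (Submodule.smul_mem _ c hva)).1 hmem) hu
      · exact ⟨i, hi, hmem⟩
    choose g hgs hg using key
    have hinj : Function.Injective fun c : K => (⟨g c, hgs c⟩ : s) := by
      intro c d hcd
      have hcd' : g c = g d := congrArg Subtype.val hcd
      by_contra hne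
      have h1 := hg c
      rw [hcd'] at h1
      have h2 := Submodule.sub_mem _ h1 (hg d)
      rw [add_sub_add_left_eq_sub, ← sub_smul] at h2
      exact hv _ (hgs d) ((Submodule.smul_mem_iff _ (sub_ne_zero.2 hne)).1 h2)
    have := Nat.card_le_card_of_injective _ hinj
    simp at this
    omega

open Module LinearMap in
/-- Over a field with enough elements, one matrix `M` with `r` columns makes the column spaces of
all the products `A k * M` simultaneously as independent as possible of given subspaces `U k`. -/
theorem Matrix.exists_min_le_finrank_range_mul_sup {K n κ : Type*} [Field K] [Finite K] [Fintype n]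
    [Fintype κ] (hκ : Fintype.card κ ≤ Nat.card K) {m : κ → Type*} [∀ k, Fintype (m k)]
    (A : ∀ k, Matrix (m k) n K) (U : ∀ k, Submodule K (m k → K)) (r : ℕ) :
    ∃ M : Matrix n (Fin r) K, ∀ k,
      min (r + finrank K (U k)) (finrank K ↥(range (A k).mulVecLin ⊔ U k)) ≤
        finrank K ↥(range (A k * M).mulVecLin ⊔ U k) := by
  classical
  induction r with
  | zero =>
    refine ⟨0, fun k => (min_le_left _ _).trans ?_⟩
    rw [zero_add]
    exact Submodule.finrank_mono le_sup_right
  | succ r ih =>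
    obtain ⟨M, hM⟩ := ih
    -- The new column must raise the dimension for each k not yet saturated. For a saturated k the
    -- second term of the minimum is already reached.
    obtain ⟨v, hv⟩ := Submodule.exists_forall_notMem_of_card_le
      (fun k => (range (A k * M).mulVecLin ⊔ U k).comap (A k).mulVecLin)
      (Finset.univ.filter fun k =>
        ¬ range (A k).mulVecLin ≤ range (A k * M).mulVecLin ⊔ U k)
      ((Finset.card_le_univ _).trans hκ) (by
        intro k hk htop
        refine (Finset.mem_filter.1 hk).2 ?_
        rintro _ ⟨x, rfl⟩
        have : x ∈ (⊤ : Submodule K (n → K)) := trivial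
        rwa [← htop] at this)
    refine ⟨Matrix.of fun i => Fin.cons (v i) (M i), fun k => ?_⟩
    set M' : Matrix n (Fin (r + 1)) K := Matrix.of fun i => Fin.cons (v i) (M i) with hM'
    have hle : range (A k * M).mulVecLin ≤ range (A k * M').mulVecLin := by
      rw [Matrix.range_mulVecLin (A k * M), Submodule.span_le]
      rintro _ ⟨j, rfl⟩
      rw [Matrix.range_mulVecLin]
      refine Submodule.subset_span ⟨j.succ, ?_⟩
      ext i
      simp [Matrix.mul_apply, hM']
    have hmem : (A k).mulVecLin v ∈ range (A k * M').mulVecLin := by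
      rw [Matrix.range_mulVecLin]
      refine Submodule.subset_span ⟨0, ?_⟩
      ext i
      simp [Matrix.mul_apply, hM', Matrix.mulVec, dotProduct]
    have hmono : range (A k * M).mulVecLin ⊔ U k ≤ range (A k * M').mulVecLin ⊔ U k :=
      sup_le_sup_right hle _
    by_cases hk : range (A k).mulVecLin ≤ range (A k * M).mulVecLin ⊔ U k
    · exact (min_le_right _ _).trans
        (Submodule.finrank_mono ((sup_le hk le_sup_right).trans hmono))
    · have hlt : range (A k * M).mulVecLin ⊔ U k < range (A k * M').mulVecLin ⊔ U k := by
        refine lt_of_le_of_ne hmono fun heq => hv k (Finset.mem_filter.2 ⟨Finset.mem_univ k, hk⟩) ?_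
        rw [Submodule.mem_comap, heq]
        exact Submodule.mem_sup_left hmem
      have h1 := Submodule.finrank_lt_finrank_of_lt hlt
      have h2 := hM k
      omega

/-! ### Ranks, direct sums and decoders -/

theorem Matrix.rank_fromCols_eq_finrank_sup {K m n₁ n₂ : Type*} [Field K]
    [Fintype n₁] [Fintype n₂] (A : Matrix m n₁ K) (B : Matrix m n₂ K) :
    (Matrix.fromCols A B).rank =
      Module.finrank K ↥(LinearMap.range A.mulVecLin ⊔ LinearMap.range B.mulVecLin) := by
  have h : (Matrix.fromCols A B).col = Sum.elim A.col B.col := by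
    ext i j
    rcases i with i | i <;> rfl
  rw [Matrix.rank_eq_finrank_span_cols, Matrix.range_mulVecLin, Matrix.range_mulVecLin,
    ← Submodule.span_union, h, Set.Sum.elim_range]

theorem Matrix.range_mulVecLin_mul_le {K m n o : Type*} [Field K] [Fintype n] [Fintype o]
    (A : Matrix m n K) (B : Matrix n o K) :
    LinearMap.range (A * B).mulVecLin ≤ LinearMap.range A.mulVecLin := by
  rw [Matrix.mulVecLin_mul]
  exact LinearMap.range_comp_le_range _ _

theorem Matrix.finrank_range_mulVecLin_le {K m : Type*} [Field K] {r : ℕ}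
    (A : Matrix m (Fin r) K) : Module.finrank K (LinearMap.range A.mulVecLin) ≤ r := by
  simpa using LinearMap.finrank_range_le A.mulVecLin

/-- A linear injection from `K ^ r` whose range is in direct sum with `U`, detected by
dimensions. -/
theorem LinearMap.injective_and_disjoint_of_le_finrank_sup {K W : Type*} [Field K]
    [AddCommGroup W] [Module K W] [FiniteDimensional K W] {r : ℕ} (f : (Fin r → K) →ₗ[K] W)
    (U : Submodule K W)
    (h : r + Module.finrank K U ≤ Module.finrank K ↥(LinearMap.range f ⊔ U)) :
    Function.Injective f ∧ Disjoint (LinearMap.range f) U := by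
  have h1 := Submodule.finrank_sup_add_finrank_inf_eq (LinearMap.range f) U
  have h2 := f.finrank_range_add_finrank_ker
  rw [Module.finrank_fin_fun] at h2
  constructor
  · rw [← LinearMap.ker_eq_bot, ← Submodule.finrank_eq_zero (R := K)]
    omega
  · rw [disjoint_iff, ← Submodule.finrank_eq_zero (R := K)]
    omega

/-- The summand `f x` of `f x + y` can be decoded when `y` is known to lie in a subspace which is
in direct sum with the range of the injection `f`. -/
theorem LinearMap.exists_decoder {K X W : Type*} [Field K] [AddCommGroup X] [Module K X]
    [AddCommGroup W] [Module K W] (f : X →ₗ[K] W) (U : Submodule K W)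
    (hf : Function.Injective f) (hU : Disjoint (LinearMap.range f) U) :
    ∃ D : W → X, ∀ x, ∀ y ∈ U, D (f x + y) = x := by
  classical
  -- The default 0 is never used on vectors f x + y with y in U.
  refine ⟨fun w => if h : ∃ x, w - f x ∈ U then h.choose else 0, fun x y hy => ?_⟩
  have h : ∃ x', f x + y - f x' ∈ U := ⟨x, by simpa using hy⟩
  beta_reduce
  rw [dif_pos h]
  refine hf ?_
  have h1 := h.choose_spec
  have h2 : f x - f h.choose ∈ U := by
    have := U.sub_mem h1 hy
    rwa [show f x + y - f h.choose - y = f x - f h.choose by abel] at this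
  have h3 := Submodule.disjoint_def.1 hU _ ⟨x - h.choose, map_sub _ _ _⟩ h2
  exact (sub_eq_zero.1 h3).symm

/-! ### Linearity of the network -/

namespace TwoUnicast

section Coding

variable {V E F : Type*} [Fintype E] [DecidableEq E] [DecidableEq V] [Field F]

theorem edgeSignal_eq_sum (N : TwoUnicast V E) (f : E → E → F) (x : E → F) (e : E) :
    N.edgeSignal f x e = ∑ a, N.edgeSignal f (Pi.single a 1) e * x a := by
  induction e using N.wellFounded_edge.induction with
  | _ e ih =>
    have h : ∀ e' : N.In (N.tail e), f e'.1 e * N.edgeSignal f x e'.1 =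
        ∑ a, f e'.1 e * N.edgeSignal f (Pi.single a 1) e'.1 * x a := by
      intro e'
      rw [ih e'.1 e'.2, Finset.mul_sum]
      simp only [mul_assoc]
    rw [edgeSignal_eq, Finset.sum_congr rfl fun e' _ => h e', Finset.sum_comm]
    have h' : ∀ a, N.edgeSignal f (Pi.single a 1) e * x a =
        (Pi.single a (1 : F) : E → F) e * x a +
          ∑ e' : N.In (N.tail e), f e'.1 e * N.edgeSignal f (Pi.single a 1) e'.1 * x a := by
      intro a
      rw [edgeSignal_eq N f (Pi.single a 1) e, add_mul, Finset.sum_mul]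
    simp only [h', Finset.sum_add_distrib]
    congr 1
    simp [Pi.single_apply]

theorem received_eq (N : TwoUnicast V E) (f : E → E → F) (i : Fin 2)
    (u₁ : N.Out (N.s 0) → F) (u₂ : N.Out (N.s 1) → F) :
    N.received f i u₁ u₂ =
      (N.transfer f i 0).mulVec u₁ + (N.transfer f i 1).mulVec u₂ := by
  have h01 : N.s 1 ≠ N.s 0 := fun h => by simpa using N.s_injective h
  ext d
  have h0 : ∀ a, N.injected u₁ u₂ a = (if h : N.tail a = N.s 0 then u₁ ⟨a, h⟩ else 0) +
      (if h : N.tail a = N.s 1 then u₂ ⟨a, h⟩ else 0) := by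
    intro a
    unfold injected
    by_cases h : N.tail a = N.s 0
    · have h' : N.tail a ≠ N.s 1 := fun h' => h01 (h'.symm.trans h)
      simp [h, h01.symm]
    · simp [h]
  have key : ∀ (v : V) (u : N.Out v → F),
      ∑ a, N.edgeSignal f (Pi.single a 1) d.1 * (if h : N.tail a = v then u ⟨a, h⟩ else 0) =
        ∑ a : N.Out v, N.edgeSignal f (Pi.single a.1 1) d.1 * u a := by
    intro v u
    rw [← Finset.sum_subset (Finset.subset_univ (Finset.univ.filter fun a => N.tail a = v))]
    · rw [Finset.sum_subtype (p := fun a => N.tail a = v) _ (by simp)]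
      exact Finset.sum_congr rfl fun a _ => by rw [dif_pos a.2]
    · intro a _ ha
      rw [dif_neg (by simpa using ha), mul_zero]
  simp only [received, signal, edgeSignal_eq_sum N f (N.injected u₁ u₂), h0, mul_add,
    Finset.sum_add_distrib, key, Pi.add_apply, Matrix.mulVec, dotProduct, transfer, Matrix.of_apply]

/-! ### Global coding vectors and topological order -/

open Classical in
/-- The global coding vector of the edge `e`: its coordinate at an edge `a` leaving a node of `S`
is the gain from `a` to `e`, the other coordinates vanish. -/
noncomputable def codingVector (N : TwoUnicast V E) (f : E → E → F) (S : Set V) (e : E) : E → F :=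
  fun a => if N.tail a ∈ S then N.edgeSignal f (Pi.single a 1) e else 0

open Classical in
theorem codingVector_eq (N : TwoUnicast V E) (f : E → E → F) (S : Set V) (e : E) :
    N.codingVector f S e = (if N.tail e ∈ S then Pi.single e 1 else 0) +
      ∑ e' : N.In (N.tail e), f e'.1 e • N.codingVector f S e'.1 := by
  ext a
  simp only [codingVector, Pi.add_apply, Finset.sum_apply, Pi.smul_apply, smul_eq_mul]
  by_cases ha : N.tail a ∈ S
  · simp only [if_pos ha]
    rw [edgeSignal_eq]
    congr 1
    by_cases hae : a = e
    · subst hae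
      simp [ha]
    · split_ifs <;> simp [hae, Ne.symm hae]
  · by_cases hae : a = e
    · subst hae
      simp [ha]
    · split_ifs <;> simp [hae]

theorem codingVector_eq_of_notMem (N : TwoUnicast V E) (f : E → E → F) (S : Set V) (e : E)
    (he : N.tail e ∉ S) :
    N.codingVector f S e = ∑ e' : N.In (N.tail e), f e'.1 e • N.codingVector f S e'.1 := by
  rw [codingVector_eq, if_neg he, zero_add]

omit [DecidableEq E] [DecidableEq V] in
/-- The edges can be numbered compatibly with the direction of the flow. -/
theorem exists_topological_numbering (N : TwoUnicast V E) :
    ∃ τ : E → ℕ, Function.Injective τ ∧ ∀ e' e, N.head e' = N.tail e → τ e' < τ e := by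
  classical
  let r : E → E → Prop := Relation.TransGen fun e' e : E => N.head e' = N.tail e
  have hirr : ∀ e, ¬ r e e := fun e h => by
    have hwf : WellFounded r := N.wellFounded_edge.transGen
    exact hwf.irrefl.irrefl e h
  let d : E → ℕ := fun e => (Finset.univ.filter fun a => r a e).card
  have hd : ∀ e' e, N.head e' = N.tail e → d e' < d e := by
    intro e' e h
    have hr : r e' e := Relation.TransGen.single h
    refine Finset.card_lt_card (Finset.ssubset_iff_of_subset ?_ |>.2 ⟨e', ?_, ?_⟩)
    · intro a ha
      simp only [Finset.mem_filter, Finset.mem_univ, true_and] at ha ⊢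
      exact ha.trans hr
    · simpa using hr
    · simpa using hirr e'
  -- The ancestor count d may have ties; an arbitrary index below |E| breaks them once d is scaled
  -- by |E|.
  let φ := Fintype.equivFin E
  refine ⟨fun e => d e * Fintype.card E + φ e, ?_, ?_⟩
  · intro a b hab
    have ha := (φ a).2
    have hb := (φ b).2
    have hmod := congrArg (· % Fintype.card E) hab
    simp only [Nat.mul_add_mod_self_right, Nat.mod_eq_of_lt ha, Nat.mod_eq_of_lt hb] at hmod
    exact φ.injective (Fin.ext hmod)
  · intro e' e h
    have h1 := hd e' e h
    have h2 := (φ e').2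
    calc d e' * Fintype.card E + φ e' < (d e' + 1) * Fintype.card E := by
          rw [add_mul, one_mul]; omega
      _ ≤ d e * Fintype.card E := Nat.mul_le_mul_right _ h1
      _ ≤ _ := Nat.le_add_right _ _

-- Signals depend only on coefficients at earlier edges or at the edge itself, so coefficients can
-- be fixed one edge at a time.
omit [DecidableEq E] in
theorem edgeSignal_congr (N : TwoUnicast V E) {τ : E → ℕ}
    (hτ : ∀ e' e, N.head e' = N.tail e → τ e' < τ e) {f g : E → E → F} {n : ℕ}
    (hfg : ∀ a b, τ b < n → f a b = g a b) (x : E → F) (e : E) (he : τ e < n) :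
    N.edgeSignal f x e = N.edgeSignal g x e := by
  induction e using N.wellFounded_edge.induction with
  | _ e ih =>
    rw [edgeSignal_eq, edgeSignal_eq N g]
    congr 1
    refine Finset.sum_congr rfl fun e' _ => ?_
    rw [hfg _ _ he, ih e'.1 e'.2 ((hτ _ _ e'.2).trans he)]

theorem codingVector_congr (N : TwoUnicast V E) {τ : E → ℕ}
    (hτ : ∀ e' e, N.head e' = N.tail e → τ e' < τ e) {f g : E → E → F} {n : ℕ}
    (hfg : ∀ a b, τ b < n → f a b = g a b) (S : Set V) (e : E) (he : τ e < n) :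
    N.codingVector f S e = N.codingVector g S e := by
  ext a
  simp only [codingVector, N.edgeSignal_congr hτ hfg _ e he]

theorem codingVector_apply_eq_zero (N : TwoUnicast V E) {τ : E → ℕ}
    (hτ : ∀ e' e, N.head e' = N.tail e → τ e' < τ e) (f : E → E → F) (S : Set V) (a e : E)
    (he : τ e < τ a) : N.codingVector f S e a = 0 := by
  suffices h : N.edgeSignal f (Pi.single a 1) e = 0 by simp [codingVector, h]
  induction e using N.wellFounded_edge.induction with
  | _ e ih =>
    have hea : e ≠ a := by
      rintro rfl
      exact lt_irrefl _ he
    rw [edgeSignal_eq, Finset.sum_eq_zero fun e' _ => by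
      rw [ih e'.1 e'.2 ((hτ _ _ e'.2).trans he), mul_zero]]
    simp [hea]

/-- Together with `codingVector_apply_eq_zero` this is triangularity: the vector of a source edge is
never in the span of earlier ones. -/
theorem codingVector_source_apply_self (N : TwoUnicast V E) (f : E → E → F) (A : Set (Fin 2))
    (e : E) (he : N.tail e ∈ N.s '' A) : N.codingVector f (N.s '' A) e e = 1 := by
  obtain ⟨i, hi, his⟩ := he
  have : IsEmpty (N.In (N.tail e)) := ⟨fun e' => N.no_edge_into_source e'.1 i (e'.2.trans his.symm)⟩
  rw [codingVector_eq, if_pos ⟨i, hi, his⟩]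
  simp

/-! ### Generic local coefficients attain the min-cuts -/

/-- The local coefficients at `e` are generic: the coding vector of `e` lies in the span of coding
vectors of earlier edges only if it cannot be avoided. -/
def IsGenericAt (N : TwoUnicast V E) (τ : E → ℕ) (f : E → E → F) (e : E) : Prop :=
  ∀ (A : Set (Fin 2)) (B : Finset E), (∀ b ∈ B, τ b < τ e) →
    N.codingVector f (N.s '' A) e ∈ Submodule.span F (N.codingVector f (N.s '' A) '' B) →
    ∀ e', N.head e' = N.tail e →
      N.codingVector f (N.s '' A) e' ∈ Submodule.span F (N.codingVector f (N.s '' A) '' B)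

/-- Choosing the coefficients at e leaves earlier edges untouched. If some edge into the tail of e
has its vector outside the span for (A, B), the bad coefficient tuples form a proper subspace, and
there are at most as many such subspaces as pairs (A, B). -/
theorem exists_isGenericAt [Finite F] (N : TwoUnicast V E) {τ : E → ℕ}
    (hinj : Function.Injective τ) (hτ : ∀ e' e, N.head e' = N.tail e → τ e' < τ e)
    (hF : Nat.card (Set (Fin 2) × Finset E) ≤ Nat.card F) (n : ℕ) :
    ∃ f : E → E → F, ∀ e, τ e < n → N.IsGenericAt τ f e := by
  classical
  induction n with
  | zero => exact ⟨0, by simp⟩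
  | succ n ih =>
    obtain ⟨f, hf⟩ := ih
    by_cases hn : ∃ e, τ e = n
    swap
    · refine ⟨f, fun e he => hf e ?_⟩
      push Not at hn
      exact lt_of_le_of_ne (Nat.lt_succ_iff.1 he) (hn e)
    obtain ⟨e, rfl⟩ := hn
    let v : Set (Fin 2) → E → E → F := fun A => N.codingVector f (N.s '' A)
    obtain ⟨c, hc⟩ := Submodule.exists_forall_notMem_of_card_le
      (fun k : Set (Fin 2) × Finset E =>
        (Submodule.span F (v k.1 '' k.2)).comap
          (Fintype.linearCombination F fun e' : N.In (N.tail e) => v k.1 e'.1))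
      (Finset.univ.filter fun k => ∃ e', N.head e' = N.tail e ∧
        v k.1 e' ∉ Submodule.span F (v k.1 '' k.2))
      ((Finset.card_le_univ _).trans (by rwa [← Nat.card_eq_fintype_card])) (by
        rintro ⟨A, B⟩ hk htop
        obtain ⟨e', he', hmem⟩ := (Finset.mem_filter.1 hk).2
        refine hmem ?_
        have : Pi.single ⟨e', he'⟩ 1 ∈ (⊤ : Submodule F (N.In (N.tail e) → F)) := trivial
        rw [← htop, Submodule.mem_comap, Fintype.linearCombination_apply_single] at this
        simpa using this)
    let g : E → E → F := fun a b =>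
      if b = e then (if h : N.head a = N.tail e then c ⟨a, h⟩ else 0) else f a b
    have hfg : ∀ a b, τ b < τ e → g a b = f a b := by
      intro a b hb
      have : b ≠ e := by
        rintro rfl
        exact lt_irrefl _ hb
      simp [g, this]
    have hgv : ∀ (A : Set (Fin 2)) (b : E), τ b < τ e → N.codingVector g (N.s '' A) b = v A b :=
      fun A b hb => N.codingVector_congr hτ hfg _ b hb
    have himage : ∀ (A : Set (Fin 2)) (B : Finset E), (∀ b ∈ B, τ b < τ e) →
        N.codingVector g (N.s '' A) '' B = v A '' B :=
      fun A B hB => Set.image_congr fun b hb => hgv A b (hB b hb)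
    refine ⟨g, fun e₁ he₁ => ?_⟩
    rcases (Nat.lt_succ_iff.1 he₁).lt_or_eq with hlt | heq
    · intro A B hB hmem e' he'
      rw [himage A B fun b hb => (hB b hb).trans hlt] at hmem ⊢
      rw [hgv A _ hlt] at hmem
      rw [hgv A _ ((hτ _ _ he').trans hlt)]
      exact hf e₁ hlt A B hB hmem e' he'
    · obtain rfl := hinj heq
      intro A B hB hmem e' he'
      rw [himage A B hB] at hmem ⊢
      rw [hgv A _ (hτ _ _ he')]
      by_contra hnot
      refine hc (A, B) (Finset.mem_filter.2 ⟨Finset.mem_univ _, e', he', hnot⟩) ?_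
      rw [Submodule.mem_comap, Fintype.linearCombination_apply]
      have hsource : N.tail e₁ ∉ N.s '' A := by
        rintro ⟨i, -, hi⟩
        exact N.no_edge_into_source e' i (he'.trans hi.symm)
      rw [codingVector_eq_of_notMem N g _ _ hsource] at hmem
      convert hmem using 1
      refine Finset.sum_congr rfl fun e'' _ => ?_
      rw [hgv A _ (hτ _ _ e''.2)]
      simp [g, e''.2]

/-- The rank of the information about the sources in `A` on the edges of `B` is at least the size
of some set of edges blocking all paths from these sources that end with an edge of `B`. -/
theorem exists_blocking_card_le (N : TwoUnicast V E) {τ : E → ℕ}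
    (hinj : Function.Injective τ) (hτ : ∀ e' e, N.head e' = N.tail e → τ e' < τ e)
    {f : E → E → F} (hf : ∀ e, N.IsGenericAt τ f e) (A : Set (Fin 2)) (n : ℕ) :
    ∀ B : Finset E, (∀ b ∈ B, τ b < n) → ∃ C : Finset E,
      C.card ≤ Set.finrank F (N.codingVector f (N.s '' A) '' B) ∧
      ∀ b ∈ B, b ∈ C ∨ ∀ v ∈ N.s '' A,
        ¬ Relation.ReflTransGen (fun u w => ∃ e, e ∉ C ∧ N.tail e = u ∧ N.head e = w)
          v (N.tail b) := by
  induction n with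
  | zero =>
    intro B hB
    exact ⟨∅, by simp, fun b hb => absurd (hB b hb) (Nat.not_lt_zero _)⟩
  | succ n ih =>
    intro B hB
    by_cases hn : ∃ e ∈ B, τ e = n
    swap
    · push Not at hn
      exact ih B fun b hb => lt_of_le_of_ne (Nat.lt_succ_iff.1 (hB b hb)) (hn b hb)
    obtain ⟨e, heB, rfl⟩ := hn
    set w := N.codingVector f (N.s '' A) with hw
    have hlt : ∀ b ∈ B.erase e, τ b < τ e := fun b hb =>
      lt_of_le_of_ne (Nat.lt_succ_iff.1 (hB b (Finset.mem_of_mem_erase hb)))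
        fun h => Finset.ne_of_mem_erase hb (hinj h)
    have himage : w '' B = insert (w e) (w '' (B.erase e)) := by
      rw [← Set.image_insert_eq, ← Finset.coe_insert, Finset.insert_erase heB]
    by_cases hmem : w e ∈ Submodule.span F (w '' (B.erase e))
    -- Genericity lets e be replaced by the edges into its tail without enlarging the span; whatever
    -- blocks those blocks e.
    · have hin := hf e A _ hlt hmem
      have hsource : N.tail e ∉ N.s '' A := by
        intro h
        have h1 := N.codingVector_source_apply_self f A e h
        have h2 : Submodule.span F (w '' (B.erase e)) ≤ LinearMap.ker (LinearMap.proj e) := by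
          rw [Submodule.span_le]
          rintro _ ⟨b, hb, rfl⟩
          exact N.codingVector_apply_eq_zero hτ f _ e b (hlt b hb)
        have h3 : w e e = 0 := h2 hmem
        exact one_ne_zero (h1.symm.trans h3)
      obtain ⟨C, hC, hblock⟩ := ih (B.erase e ∪ Finset.univ.filter fun a => N.head a = N.tail e) (by
        intro b hb
        rcases Finset.mem_union.1 hb with hb | hb
        · exact hlt b hb
        · exact hτ _ _ (Finset.mem_filter.1 hb).2)
      refine ⟨C, hC.trans ?_, fun b hb => ?_⟩
      · refine Submodule.finrank_mono ?_
        rw [Submodule.span_le]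
        have hmono : Submodule.span F (w '' (B.erase e)) ≤ Submodule.span F (w '' B) :=
          Submodule.span_mono (by rw [himage]; exact Set.subset_insert _ _)
        rintro _ ⟨b, hb, rfl⟩
        rcases Finset.mem_union.1 hb with hb | hb
        · exact hmono (Submodule.subset_span ⟨b, hb, rfl⟩)
        · exact hmono (hin b (Finset.mem_filter.1 hb).2)
      · by_cases hbe : b = e
        · subst hbe
          right
          intro v hv hpath
          rcases Relation.ReflTransGen.cases_tail hpath with h | ⟨u, hu, a, haC, hau, hab⟩
          · exact hsource (h ▸ hv)
          · subst hau
            rcases hblock a (Finset.mem_union_right _ (by simpa using hab)) with h | h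
            · exact haC h
            · exact h v hv hu
        · exact hblock b (Finset.mem_union_left _ (Finset.mem_erase.2 ⟨hbe, hb⟩))
    -- Here e contributes a new dimension, which pays for adding e itself to the blocking set.
    · obtain ⟨C, hC, hblock⟩ := ih _ hlt
      refine ⟨insert e C, (Finset.card_insert_le _ _).trans ?_, fun b hb => ?_⟩
      · refine (Nat.succ_le_succ hC).trans (Submodule.finrank_lt_finrank_of_lt ?_)
        refine lt_of_le_of_ne
          (Submodule.span_mono (by rw [himage]; exact Set.subset_insert _ _)) fun h => hmem ?_
        rw [h]
        exact Submodule.subset_span ⟨e, heB, rfl⟩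
      · by_cases hbe : b = e
        · exact Or.inl (hbe ▸ Finset.mem_insert_self _ _)
        · refine (hblock b (Finset.mem_erase.2 ⟨hbe, hb⟩)).imp
            (fun h => Finset.mem_insert_of_mem h) fun h v hv hpath => h v hv ?_
          exact Relation.ReflTransGen.mono
            (fun _ _ ⟨a, ha, h⟩ => ⟨a, fun haC => ha (Finset.mem_insert_of_mem haC), h⟩) _ _ hpath

/-- Everything that the edges entering `T` carry about the sources of `A` is determined by what
the edges of a cut carry. -/
theorem codingVector_mem_span_of_separates (N : TwoUnicast V E) (f : E → E → F) {C : Finset E}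
    {S T : Set V} (hC : N.Separates C S T) (e : E) (he : N.head e ∈ T) :
    N.codingVector f S e ∈ Submodule.span F (N.codingVector f S '' C) := by
  have key : ∀ e, (∀ v ∈ S,
      ¬ Relation.ReflTransGen (fun u w => ∃ e, e ∉ C ∧ N.tail e = u ∧ N.head e = w)
        v (N.head e)) →
      N.codingVector f S e ∈ Submodule.span F (N.codingVector f S '' C) := by
    intro e
    induction e using N.wellFounded_edge.induction with
    | _ e ih =>
      intro h
      by_cases heC : e ∈ C
      · exact Submodule.subset_span ⟨e, heC, rfl⟩
      -- An edge outside C with unreachable head has an unreachable tail, so it leaves no source and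
      -- only combines edges covered by induction.
      have htail : ∀ v ∈ S,
          ¬ Relation.ReflTransGen (fun u w => ∃ e, e ∉ C ∧ N.tail e = u ∧ N.head e = w)
            v (N.tail e) :=
        fun v hv hpath => h v hv (hpath.tail ⟨e, heC, rfl, rfl⟩)
      rw [codingVector_eq_of_notMem N f S e fun hS => htail _ hS .refl]
      refine Submodule.sum_mem _ fun e' _ => Submodule.smul_mem _ _ (ih e'.1 e'.2 ?_)
      rwa [e'.2]
  exact key e fun v hv => hC v hv _ he

/-- With generic local coefficients a terminal learns about the sources in `A` as much as the
minimum cut allows. -/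
theorem finrank_codingVector_eq_cut (N : TwoUnicast V E) {τ : E → ℕ}
    (hinj : Function.Injective τ) (hτ : ∀ e' e, N.head e' = N.tail e → τ e' < τ e)
    {f : E → E → F} (hf : ∀ e, N.IsGenericAt τ f e) (A : Set (Fin 2)) (i : Fin 2) :
    Set.finrank F (N.codingVector f (N.s '' A) '' {e | N.head e = N.t i}) = N.cut A {i} := by
  obtain ⟨C, hC, hblock⟩ := N.exists_blocking_card_le hinj hτ hf A
    (Finset.univ.sup τ + 1) (Finset.univ.filter fun e => N.head e = N.t i)
    fun b _ => Nat.lt_succ_iff.2 (Finset.le_sup (Finset.mem_univ b))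
  rw [Finset.coe_filter_univ] at hC
  have hsep : N.Separates C (N.s '' A) (N.t '' {i}) := by
    rw [Set.image_singleton]
    intro v hv w hw hpath
    obtain rfl : w = N.t i := hw
    rcases Relation.ReflTransGen.cases_tail hpath with h | ⟨u, hu, a, haC, hau, hat⟩
    · obtain ⟨j, -, rfl⟩ := hv
      exact N.s_ne_t j _ h.symm
    · subst hau
      rcases hblock a (by simpa using hat) with h | h
      · exact haC h
      · exact h v hv hu
  have hle : N.cut A {i} ≤ C.card := Nat.sInf_le ⟨C, rfl, hsep⟩
  -- The blocking set is a cut, giving one inequality; the other holds because the vectors on a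
  -- minimum cut span everything received.
  refine le_antisymm ?_ (hle.trans hC)
  obtain ⟨C', hC', hsep'⟩ := Nat.sInf_mem
    (s := {n : ℕ | ∃ C : Finset E, C.card = n ∧ N.Separates C (N.s '' A) (N.t '' {i})})
    ⟨_, C, rfl, hsep⟩
  rw [cut, ← hC']
  classical
  have h1 : Submodule.span F (N.codingVector f (N.s '' A) '' {e | N.head e = N.t i}) ≤
      Submodule.span F (N.codingVector f (N.s '' A) '' C') := by
    rw [Submodule.span_le]
    rintro _ ⟨e, he, rfl⟩
    exact N.codingVector_mem_span_of_separates f hsep' e ⟨i, rfl, Eq.symm he⟩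
  refine (Submodule.finrank_mono h1).trans ?_
  rw [← Finset.coe_image]
  exact (finrank_span_finset_le_card _).trans Finset.card_image_le

/-! ### From coding vectors to transfer matrices -/

/-- The rank of a matrix of gains, in terms of global coding vectors. -/
theorem rank_eq_finrank_codingVector (N : TwoUnicast V E) (f : E → E → F) {S : Set V} {v : V}
    {X : Type*} [Fintype X] {g : X → E} (hg : Function.Injective g)
    (hS : ∀ a, N.tail a ∈ S ↔ a ∈ Set.range g) (M : Matrix (N.In v) X F)
    (hM : ∀ d x, M d x = N.edgeSignal f (Pi.single (g x) 1) d.1) :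
    M.rank = Set.finrank F (N.codingVector f S '' {e | N.head e = v}) := by
  let φ : (X → F) →ₗ[F] (E → F) := Function.ExtendByZero.linearMap F g
  have hφ : Function.Injective φ := by
    intro x y hxy
    ext i
    have := congrFun hxy (g i)
    simpa [φ, hg.extend_apply] using this
  have hrow : ∀ d : N.In v, φ (M.row d) = N.codingVector f S d.1 := by
    intro d
    ext a
    by_cases ha : a ∈ Set.range g
    · have ha' := (hS a).2 ha
      obtain ⟨x, rfl⟩ := ha
      simp [φ, hg.extend_apply, codingVector, ha', hM, Matrix.row]
    · have ha' : N.tail a ∉ S := fun h => ha ((hS a).1 h)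
      simp only [φ, codingVector, if_neg ha', Function.ExtendByZero.linearMap_apply]
      rw [Function.extend_apply' _ _ _ ha]
      rfl
  have himage : N.codingVector f S '' {e | N.head e = v} = φ '' Set.range M.row := by
    ext w
    constructor
    · rintro ⟨e, he, rfl⟩
      exact ⟨_, ⟨⟨e, he⟩, rfl⟩, hrow ⟨e, he⟩⟩
    · rintro ⟨_, ⟨d, rfl⟩, rfl⟩
      exact ⟨d.1, d.2, (hrow d).symm⟩
  rw [Matrix.rank_eq_finrank_span_row, himage, Set.finrank, Submodule.span_image]
  exact (Submodule.equivMapOfInjective φ hφ _).finrank_eq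

theorem hasCutRanks_of_isGenericAt (N : TwoUnicast V E) {τ : E → ℕ}
    (hinj : Function.Injective τ) (hτ : ∀ e' e, N.head e' = N.tail e → τ e' < τ e)
    {f : E → E → F} (hf : ∀ e, N.IsGenericAt τ f e) : N.HasCutRanks f where
  rank_transfer i j := by
    rw [← N.finrank_codingVector_eq_cut hinj hτ hf {j} i]
    refine N.rank_eq_finrank_codingVector f (g := Subtype.val) Subtype.val_injective ?_ _
      fun d x => rfl
    intro a
    simp
  rank_fromCols i := by
    rw [← N.finrank_codingVector_eq_cut hinj hτ hf {0, 1} i]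
    have h01 : N.s 0 ≠ N.s 1 := fun h => by simpa using N.s_injective h
    refine N.rank_eq_finrank_codingVector f (g := Sum.elim Subtype.val Subtype.val) ?_ ?_ _ ?_
    · refine Subtype.val_injective.sumElim Subtype.val_injective ?_
      rintro ⟨a, ha⟩ ⟨b, hb⟩ rfl
      exact h01 (ha.symm.trans hb)
    · intro a
      simp [Set.image_pair, Set.Sum.elim_range]
    · rintro d (x | x) <;> rfl

theorem exists_hasCutRanks [Finite F] (N : TwoUnicast V E)
    (hF : Nat.card (Set (Fin 2) × Finset E) ≤ Nat.card F) : ∃ f : E → E → F, N.HasCutRanks f := by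
  obtain ⟨τ, hinj, hτ⟩ := N.exists_topological_numbering
  obtain ⟨f, hf⟩ := N.exists_isGenericAt hinj hτ hF (Finset.univ.sup τ + 1)
  exact ⟨f, N.hasCutRanks_of_isGenericAt hinj hτ fun e =>
    hf e (Nat.lt_succ_iff.2 (Finset.le_sup (Finset.mem_univ e)))⟩

/-! ### Encoding matrices and achievable rates -/

open LinearMap Module in
/-- Every rate pair satisfying the cut conditions at both terminals can be multicast. -/
theorem HasCutRanks.exists_isMulticast [Finite F] {N : TwoUnicast V E} {f : E → E → F}
    (hf : N.HasCutRanks f) (hF : 4 ≤ Nat.card F) {r₁ r₂ : ℕ}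
    (h₁ : ∀ i, r₁ ≤ N.cut {0} {i}) (h₂ : ∀ i, r₂ ≤ N.cut {1} {i})
    (h₁₂ : ∀ i, r₁ + r₂ ≤ N.cut {0, 1} {i}) :
    ∃ (M₁ : Matrix (N.Out (N.s 0)) (Fin r₁) F) (M₂ : Matrix (N.Out (N.s 1)) (Fin r₂) F),
      N.IsMulticast f M₁ M₂ := by
  -- At each terminal M₁ must be generic both on its own and modulo the range of H_{i2}, whence four
  -- conditions; M₂ then only has to be generic modulo the range of H_{i1}M₁.
  obtain ⟨M₁, hM₁⟩ := Matrix.exists_min_le_finrank_range_mul_sup (κ := Fin 2 × Bool)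
    (by simpa using hF) (fun k => N.transfer f k.1 0)
    (fun k => if k.2 then range (N.transfer f k.1 1).mulVecLin else ⊥) r₁
  obtain ⟨M₂, hM₂⟩ := Matrix.exists_min_le_finrank_range_mul_sup (κ := Fin 2)
    (by simp; omega) (fun i => N.transfer f i 1)
    (fun i => range (N.transfer f i 0 * M₁).mulVecLin) r₂
  refine ⟨M₁, M₂, fun i => ?_⟩
  have a1 : min (r₁ + finrank F (⊥ : Submodule F (N.In (N.t i) → F)))
      (finrank F ↥(range (N.transfer f i 0).mulVecLin ⊔ ⊥)) ≤
      finrank F ↥(range (N.transfer f i 0 * M₁).mulVecLin ⊔ ⊥) := hM₁ (i, false)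
  have a2 : min (r₁ + finrank F (range (N.transfer f i 1).mulVecLin))
      (finrank F ↥(range (N.transfer f i 0).mulVecLin ⊔ range (N.transfer f i 1).mulVecLin)) ≤
      finrank F ↥(range (N.transfer f i 0 * M₁).mulVecLin ⊔
        range (N.transfer f i 1).mulVecLin) := hM₁ (i, true)
  have a3 := hM₂ i
  have b1 := hf.rank_transfer i 0
  have b2 := hf.rank_transfer i 1
  have b3 := hf.rank_fromCols i
  rw [Matrix.rank_fromCols_eq_finrank_sup] at b3 ⊢
  rw [sup_bot_eq, sup_bot_eq, finrank_bot] at a1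
  rw [sup_comm, sup_comm (range (N.transfer f i 1 * M₂).mulVecLin)] at a3
  have c1 := Matrix.finrank_range_mulVecLin_le (N.transfer f i 0 * M₁)
  have c2 := Matrix.finrank_range_mulVecLin_le (N.transfer f i 1 * M₂)
  have c3 := Submodule.finrank_add_le_finrank_add_finrank
    (range (N.transfer f i 0 * M₁).mulVecLin) (range (N.transfer f i 1 * M₂).mulVecLin)
  have d1 := h₁ i
  have d2 := h₂ i
  have d3 := h₁₂ i
  simp only [Matrix.rank] at b1 b2
  omega

open LinearMap Module in
/-- If source `2` already fills the whole interference space at terminal `1` in a multicast code,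
then its encoding matrix can be changed freely, and the rates are only limited by the ranks seen
at terminal `2`. -/
theorem IsMulticast.achievableWith [Finite F] {N : TwoUnicast V E} {f : E → E → F} {r₁ r₂ : ℕ}
    {M₁ : Matrix (N.Out (N.s 0)) (Fin r₁) F} {M₂ : Matrix (N.Out (N.s 1)) (Fin r₂) F}
    (hM : N.IsMulticast f M₁ M₂) (hr₂ : (N.transfer f 0 1).rank = r₂) {R₁ R₂ : ℕ}
    (hR₁ : R₁ ≤ r₁) (hR₂ : R₂ ≤ (N.transfer f 1 1).rank)
    (hR : R₁ + R₂ ≤ (Matrix.fromCols (N.transfer f 1 0 * M₁) (N.transfer f 1 1)).rank) :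
    N.AchievableWith f R₁ R₂ := by
  have hcard : 2 ≤ Nat.card F := Finite.one_lt_card
  have h0 := hM 0
  have h1 := hM 1
  rw [Matrix.rank_fromCols_eq_finrank_sup] at h0 h1 hR
  simp only [Matrix.rank] at hr₂ hR₂
  set P := N.transfer f 1 0 * M₁ with hP
  obtain ⟨A, hA⟩ := Matrix.exists_min_le_finrank_range_mul_sup (κ := Bool)
    (by simpa using hcard) (fun _ => P)
    (fun k => if k then range (N.transfer f 1 1).mulVecLin else ⊥) R₁
  obtain ⟨M₂', hM₂'⟩ := Matrix.exists_min_le_finrank_range_mul_sup (κ := Unit)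
    (by simp; omega) (fun _ => N.transfer f 1 1) (fun _ => range (P * A).mulVecLin) R₂
  have a1 : min (R₁ + finrank F (⊥ : Submodule F (N.In (N.t 1) → F)))
      (finrank F ↥(range P.mulVecLin ⊔ ⊥)) ≤
      finrank F ↥(range (P * A).mulVecLin ⊔ ⊥) := hA false
  have a2 : min (R₁ + finrank F (range (N.transfer f 1 1).mulVecLin))
      (finrank F ↥(range P.mulVecLin ⊔ range (N.transfer f 1 1).mulVecLin)) ≤
      finrank F ↥(range (P * A).mulVecLin ⊔ range (N.transfer f 1 1).mulVecLin) := hA true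
  have a3 := hM₂' ()
  rw [sup_bot_eq, sup_bot_eq, finrank_bot] at a1
  rw [sup_comm (range (N.transfer f 1 1).mulVecLin)] at a3
  have c1 := Matrix.finrank_range_mulVecLin_le (P * A)
  have c2 := Matrix.finrank_range_mulVecLin_le (N.transfer f 1 1 * M₂)
  have c3 := Submodule.finrank_add_le_finrank_add_finrank (range P.mulVecLin)
    (range (N.transfer f 1 1 * M₂).mulVecLin)
  -- The old M₂ serves only here: multicast at terminal 2 forces P to have rank at least r₁ ≥ R₁.
  have hPA : finrank F (range (P * A).mulVecLin) = R₁ := by omega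
  have hAinj : Function.Injective A.mulVecLin := by
    have h := (LinearMap.injective_and_disjoint_of_le_finrank_sup (P * A).mulVecLin ⊥
      (by rw [sup_bot_eq, finrank_bot]; omega)).1
    rw [Matrix.mulVecLin_mul, coe_comp] at h
    exact h.of_comp
  -- As r₂ is the dimension of the whole range of H₁₂, the direct sum survives replacing the range
  -- of H₁₂M₂ by it.
  have hdec1 := LinearMap.injective_and_disjoint_of_le_finrank_sup
    (N.transfer f 0 0 * M₁).mulVecLin (range (N.transfer f 0 1).mulVecLin) (by
      rw [hr₂, ← h0]
      exact Submodule.finrank_mono (sup_le_sup_left (Matrix.range_mulVecLin_mul_le _ _) _))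
  have hdec2 := LinearMap.injective_and_disjoint_of_le_finrank_sup
    (N.transfer f 1 1 * M₂').mulVecLin (range (P * A).mulVecLin) (by omega)
  obtain ⟨D₁, hD₁⟩ := LinearMap.exists_decoder
    ((N.transfer f 0 0 * M₁).mulVecLin ∘ₗ A.mulVecLin) (range (N.transfer f 0 1).mulVecLin)
    (hdec1.1.comp hAinj) (hdec1.2.mono_left (range_comp_le_range _ _))
  obtain ⟨D₂, hD₂⟩ := LinearMap.exists_decoder _ _ hdec2.1 hdec2.2
  refine ⟨M₁ * A, M₂', D₁, D₂, fun X₁ X₂ => ⟨?_, ?_⟩⟩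
  · rw [received_eq]
    convert hD₁ X₁ _ ⟨M₂'.mulVec X₂, rfl⟩ using 3
    · simp [Matrix.mulVec_mulVec]
    · simp
  · rw [received_eq, add_comm]
    convert hD₂ X₂ _ ⟨X₁, rfl⟩ using 3
    · simp [Matrix.mulVec_mulVec]
    · simp [hP, Matrix.mulVec_mulVec]

theorem HasCutRanks.cut_both_le {N : TwoUnicast V E} {f : E → E → F} (hf : N.HasCutRanks f)
    (i : Fin 2) : N.cut {0, 1} {i} ≤ N.cut {0} {i} + N.cut {1} {i} := by
  rw [← hf.rank_fromCols, ← hf.rank_transfer, ← hf.rank_transfer,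
    Matrix.rank_fromCols_eq_finrank_sup]
  exact Submodule.finrank_add_le_finrank_add_finrank _ _

theorem HasCutRanks.cut_two_le_cut_both {N : TwoUnicast V E} {f : E → E → F}
    (hf : N.HasCutRanks f) (i : Fin 2) : N.cut {1} {i} ≤ N.cut {0, 1} {i} := by
  rw [← hf.rank_fromCols, ← hf.rank_transfer, Matrix.rank_fromCols_eq_finrank_sup]
  exact Submodule.finrank_mono le_sup_right

end Coding

end TwoUnicast

/-! ### The corollary -/

theorem mainTheorem4 {V E : Type*} [Fintype E] [DecidableEq E] [DecidableEq V]
    (N : TwoUnicast V E)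
    (hinterference : min (N.cut {0, 1} {0}) (N.cut {0, 1} {1}) ≤ N.cut {0} {1} + N.cut {1} {0})
    (hcut : N.cut {1} {0} ≤ N.cut {1} {1}) :
    -- over every large enough finite field a choice of codes for the point `Q₂` exists
    (∃ q₀ : ℕ, ∀ (F : Type*) [Field F] [Finite F], q₀ ≤ Nat.card F →
      ∃ f : E → E → F, N.HasCutRanks f ∧
        ∃ (M₁ : Matrix (N.Out (N.s 0)) (Fin N.rateQ₂one) F)
          (M₂ : Matrix (N.Out (N.s 1)) (Fin N.rateQ₂two) F), N.IsMulticast f M₁ M₂) ∧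
    -- and for every such choice the whole region is achieved with the same local coding
    (∀ (F : Type*) [Field F] [Finite F] (f : E → E → F), N.HasCutRanks f →
      ∀ (M₁ : Matrix (N.Out (N.s 0)) (Fin N.rateQ₂one) F)
        (M₂ : Matrix (N.Out (N.s 1)) (Fin N.rateQ₂two) F), N.IsMulticast f M₁ M₂ →
      ∀ R₁ R₂ : ℕ,
        (R₁ : ℤ) ≤ min (N.cut {0, 1} {0} : ℤ) (N.cut {0, 1} {1}) - N.cut {1} {0} →
        R₂ ≤ N.cut {1} {1} →
        R₁ + R₂ ≤ (Matrix.fromCols (N.transfer f 1 0 * M₁) (N.transfer f 1 1)).rank →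
        N.AchievableWith f R₁ R₂) := by
  refine ⟨⟨max 4 (Nat.card (Set (Fin 2) × Finset E)), fun F _ _ hF => ?_⟩, ?_⟩
  · obtain ⟨f, hf⟩ := N.exists_hasCutRanks (F := F) ((le_max_right _ _).trans hF)
    refine ⟨f, hf, hf.exists_isMulticast ((le_max_left _ _).trans hF) ?_ ?_ ?_⟩ <;>
    · have h0 := hf.cut_two_le_cut_both 0
      have h1 := hf.cut_two_le_cut_both 1
      simp only [Fin.forall_fin_two, TwoUnicast.rateQ₂one, TwoUnicast.rateQ₂two]
      omega
  · intro F _ _ f hf M₁ M₂ hM R₁ R₂ hR₁ hR₂ hR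
    have h0 := hf.cut_both_le 0
    refine hM.achievableWith ?_ ?_ ?_ hR
    · rw [hf.rank_transfer, TwoUnicast.rateQ₂two, min_eq_left hcut]
    -- The bound on R₁ lies below k_{1-2} by `hinterference` and below k_{1-1} by subadditivity of
    -- ranks at terminal 1, so R₁ ≤ R₁**.
    · simp only [TwoUnicast.rateQ₂one, TwoUnicast.rateQ₂two]
      omega
    · rwa [hf.rank_transfer]
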